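/- Let $\mathbb H$ be the open upper half-plane and $\overline{\mathbb H}=\{z\in\mathbb C:\operatorname{Im} z\ge 0\}$. Let $\alpha\in\mathbb C$ with $\operatorname{Im}\alpha\le 0$, let $U\subset\mathbb C$ be a simply connected domain containing $\overline{\mathbb H}\setminus\{\alpha\}$, and let $f:U\to\mathbb C$ be an injective holomorphic function such that $f(\overline{\mathbb H}\setminus\{\alpha\})$ is convex; write $f^{-1}:f(U)\to U$ for its inverse. Let $X_1,X_2,\dots$ be i.i.d. real-valued random variables whose common distribution is continuous, i.e. $P(X_1=x)=0$ for every $x\in\mathbb R$, and put $$M^f_n:=f^{-1}\Bigl(\frac1n\sum_{j=1}^n f(X_j)\Bigr),\qquad n\ge 1.$$ For a complex random variable $Y$ let $\operatorname{Var}(Y)=E\bigl[|Y-E[Y]|^2\bigr]\in[0,\infty]$. Suppose that $f(X_1)\in L^1$ and $f(X_1)\notin L^2$. Then $E[f(X_1)]\in f(\overline{\mathbb H}\setminus\{\alpha\})$ and, for every $n\ge1$, almost surely $\frac1n\sum_{j=1}^n f(X_j)\in f(\overline{\mathbb H}\setminus\{\alpha\})$, so that $f^{-1}(E[f(X_1)])$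 and the random variable $M^f_n$ are well defined (the latter almost surely), and the following hold. (i) $$\lim_{n\to\infty} n\,E\Bigl[\bigl|M^f_n-f^{-1}(E[f(X_1)])\bigr|^2\Bigr]=+\infty,$$ and, moreover, the sequence $\bigl(\sqrt n\,(M^f_n-f^{-1}(E[f(X_1)]))\bigr)_{n\ge1}$ does not converge in distribution to any probability distribution on $\mathbb C\cong\mathbb R^2$. (ii) If additionally $\limsup_{n\to\infty}E\bigl[|M^f_n|^{1+\varepsilon_0}\bigr]<+\infty$ for some $\varepsilon_0>0$, then $$\lim_{n\to\infty} n\operatorname{Var}(M^f_n)=+\infty.$$ -/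

import Mathlib

open Set Filter Topology MeasureTheory ProbabilityTheory
open scoped ENNReal

/-- The closed upper half-plane with the point `α` removed (if `α` lies below the real axis,
this is the whole closed upper half-plane). -/
def closedUpperHalfPlaneMinus (α : ℂ) : Set ℂ :=
  {z : ℂ | 0 ≤ z.im} \ {α}

/-- The standing assumption on a complex-valued generator `f` with domain `U` and
exceptional point `α`. -/
structure IsGenerator (α : ℂ) (U : Set ℂ) (f : ℂ → ℂ) : Prop where
  im_nonpos : α.im ≤ 0
  isOpen : IsOpen U
  isSimplyConnected : IsSimplyConnected U
  subset : closedUpperHalfPlaneMinus α ⊆ U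
  holomorphic : DifferentiableOn ℂ f U
  injOn : InjOn f U
  convex_image : Convex ℝ (f '' closedUpperHalfPlaneMinus α)

/-- The inverse `f⁻¹ : f(U) → U` of the generator (extended by a constant outside `f(U)`). -/
noncomputable def generatorInv (f : ℂ → ℂ) (U : Set ℂ) : ℂ → ℂ :=
  Function.invFunOn f U

/-- The arithmetic mean `(f(X₁) + ⋯ + f(Xₙ)) / n`; the sequence `X₁, X₂, …` is indexed as
`X 0, X 1, …`. -/
noncomputable def generatorAverage {Ω : Type*} (f : ℂ → ℂ) (X : ℕ → Ω → ℝ) (n : ℕ) (ω : Ω) : ℂ :=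
  (∑ j ∈ Finset.range n, f (X j ω : ℂ)) / (n : ℂ)

/-- The quasi-arithmetic mean `Mₙ = f⁻¹ ((f(X₁) + ⋯ + f(Xₙ)) / n)`. -/
noncomputable def quasiArithmeticMean {Ω : Type*} (f : ℂ → ℂ) (U : Set ℂ) (X : ℕ → Ω → ℝ)
    (n : ℕ) (ω : Ω) : ℂ :=
  generatorInv f U (generatorAverage f X n ω)

/-- The variance `E|Y - E[Y]|²` of a complex-valued random variable, with values in `[0, ∞]`. -/
noncomputable def complexVariance {Ω : Type*} [MeasurableSpace Ω] (Y : Ω → ℂ) (P : Measure Ω) :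
    ℝ≥0∞ :=
  ∫⁻ ω, ‖Y ω - ∫ ω', Y ω' ∂P‖ₑ ^ 2 ∂P

/-! An infinite second moment makes the partial sums of the `f (X j)` spread out on a scale larger
than `√n`: they leave every window of width `K * √n`, whatever its centre. By
`norm_charFun_sq_eq_integral_cos` and Fatou, `n * (1 - ‖φ (t / √n)‖ ^ 2)` tends to infinity, so the
characteristic functions of the normalized sums vanish in the limit off the origin; Gaussian
smoothing turns this into `tendsto_measure_abs_sum_sub_le`.

The strong law gives `Mₙ → m = f⁻¹ (E f(X₁))` almost surely, and `f` is Lipschitz near `m`. Were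
`Mₙ` concentrated at scale `1 / √n`, its image under `f`, the arithmetic mean, would be too. Hence
`Mₙ` is anti-concentrated about arbitrary centres `cₙ`. Centres `m` and `E Mₙ` give the two
divergent second moments by Markov, and escape of mass from every ball excludes a limit law. -/

/-! ### Means of random variables in convex sets -/

/-- The mean of a real random variable with values in a convex (not necessarily closed) set lies in
that set. -/
theorem Convex.integral_mem_real {Ω : Type*} [MeasurableSpace Ω] {P : Measure Ω}
    [IsProbabilityMeasure P] {D : Set ℝ} (hD : Convex ℝ D) {Z : Ω → ℝ} (hZ : Integrable Z P)
    (hmem : ∀ᵐ ω ∂P, Z ω ∈ D) : ∫ ω, Z ω ∂P ∈ D := by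
  have hnull : P {ω | Z ω ∉ D} = 0 := hmem
  obtain ⟨x, hx, hx'⟩ := exists_notMem_null_le_integral hZ hnull
  obtain ⟨y, hy, hy'⟩ := exists_notMem_null_integral_le hZ hnull
  simp only [mem_ofPred_eq, not_not] at hx hy
  exact hD.ordConnected.out hx hy ⟨hx', hy'⟩

/-- The mean of a complex random variable with values in a convex (not necessarily closed) set
with nonempty interior lies in that set. -/
theorem Convex.integral_mem_complex {Ω : Type*} [MeasurableSpace Ω] {P : Measure Ω}
    [IsProbabilityMeasure P] {C : Set ℂ} (hC : Convex ℝ C) (hint : (interior C).Nonempty)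
    {Y : Ω → ℂ} (hY : Integrable Y P) (hmem : ∀ᵐ ω ∂P, Y ω ∈ C) : ∫ ω, Y ω ∂P ∈ C := by
  by_contra he
  set e := ∫ ω, Y ω ∂P with he_def
  -- A supporting line at `e`: since `l ≤ l e` on `C` and `l (Y ω)` has mean `l e`, almost all of
  -- `Y` lies on that line.
  obtain ⟨l, hl⟩ := geometric_hahn_banach_open_point hC.interior isOpen_interior
    (fun h => he (interior_subset h))
  have hle : ∀ y ∈ C, l y ≤ l e := by
    intro y hy
    have hy' : y ∈ closure (interior C) := by
      rw [hC.closure_interior_eq_closure_of_nonempty_interior hint]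
      exact subset_closure hy
    exact closure_minimal (fun a ha => (hl a ha).le)
      (isClosed_le l.continuous continuous_const) hy'
  have hform : ∀ (k : StrongDual ℝ ℂ) (z : ℂ), k z = z.re * k 1 + z.im * k Complex.I := by
    intro k z
    conv_lhs => rw [show z = z.re • (1 : ℂ) + z.im • Complex.I by simp [Complex.re_add_im]]
    rw [map_add, map_smul, map_smul, smul_eq_mul, smul_eq_mul]
  have hlY : Integrable (fun ω => l (Y ω)) P := l.integrable_comp hY
  have hlint : ∫ ω, l (Y ω) ∂P = l e := l.integral_comp_comm hY
  have hzero : ∀ᵐ ω ∂P, l (Y ω) = l e := by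
    have hnn : 0 ≤ᵐ[P] fun ω => l e - l (Y ω) := by
      filter_upwards [hmem] with ω hω
      exact sub_nonneg.2 (hle _ hω)
    have h0 : ∫ ω, (l e - l (Y ω)) ∂P = 0 := by
      rw [integral_sub (integrable_const _) hlY, hlint]
      simp
    filter_upwards [(integral_eq_zero_iff_of_nonneg_ae hnn
      ((integrable_const _).sub hlY)).1 h0] with ω hω
    exact (sub_eq_zero.1 hω).symm
  set a := l 1
  set b := l Complex.I
  have hab : 0 < a ^ 2 + b ^ 2 := by
    obtain ⟨x, hx⟩ := hint
    have hlt := hl x hx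
    rw [hform l x, hform l e] at hlt
    by_contra hcon
    have ha : a = 0 := by nlinarith [sq_nonneg a, sq_nonneg b]
    have hb : b = 0 := by nlinarith [sq_nonneg a, sq_nonneg b]
    change x.re * a + x.im * b < e.re * a + e.im * b at hlt
    simp [ha, hb] at hlt
  -- The coordinate along the supporting line, orthogonal to `l`; it reduces the claim to dimension
  -- one, and `l` and `k` together determine a point.
  let k : StrongDual ℝ ℂ := a • Complex.imCLM - b • Complex.reCLM
  have hk : ∀ z, k z = a * z.im - b * z.re := fun z => by simp [k]
  have hD : Convex ℝ (k '' (C ∩ {z | l z = l e})) :=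
    (hC.inter (convex_hyperplane l.isLinear (l e))).is_linear_image k.isLinear
  have hkmem : ∫ ω, k (Y ω) ∂P ∈ k '' (C ∩ {z | l z = l e}) := by
    refine hD.integral_mem_real (k.integrable_comp hY) ?_
    filter_upwards [hmem, hzero] with ω h1 h2
    exact ⟨_, ⟨h1, h2⟩, rfl⟩
  rw [k.integral_comp_comm hY, ← he_def] at hkmem
  obtain ⟨y, ⟨hyC, hyl⟩, hyk⟩ := hkmem
  have h1 : y.re * a + y.im * b = e.re * a + e.im * b := by
    rw [← hform l y, ← hform l e]; exact hyl
  rw [hk, hk] at hyk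
  have hre : y.re = e.re := by
    have : (a ^ 2 + b ^ 2) * (y.re - e.re) = 0 := by linear_combination a * h1 - b * hyk
    rcases mul_eq_zero.1 this with h | h <;> linarith
  have him : y.im = e.im := by
    have : (a ^ 2 + b ^ 2) * (y.im - e.im) = 0 := by linear_combination b * h1 + a * hyk
    rcases mul_eq_zero.1 this with h | h <;> linarith
  exact he (Complex.ext hre him ▸ hyC)

/-! ### Analytic properties of the generator -/

namespace IsGenerator

variable {α : ℂ} {U : Set ℂ} {f : ℂ → ℂ}

theorem isOpen_image (hf : IsGenerator α U f) {s : Set ℂ} (hs : IsOpen s) (hsU : s ⊆ U) :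
    IsOpen (f '' s) := by
  have han : AnalyticOnNhd ℂ f U := hf.holomorphic.analyticOnNhd hf.isOpen
  have hUc : IsPreconnected U := hf.isSimplyConnected.isPathConnected.isConnected.isPreconnected
  have hmem : ∀ x : ℝ, 0 < x → (x : ℂ) * Complex.I ∈ U := by
    intro x hx
    refine hf.subset ⟨by simpa using hx.le, fun h => ?_⟩
    have := hf.im_nonpos
    rw [mem_singleton_iff] at h
    rw [← h] at this
    simp at this
    linarith
  -- Open mapping theorem; injectivity at `i` and `2i` excludes the constant case.
  rcases han.is_constant_or_isOpen hUc with ⟨w, hw⟩ | h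
  · have := hf.injOn (hmem 1 one_pos) (hmem 2 two_pos)
      ((hw _ (hmem 1 one_pos)).trans (hw _ (hmem 2 two_pos)).symm)
    norm_num at this
  · exact h s hsU hs

theorem generatorInv_apply (hf : IsGenerator α U f) {z : ℂ} (hz : z ∈ U) :
    generatorInv f U (f z) = z :=
  hf.injOn.leftInvOn_invFunOn hz

theorem continuousOn_generatorInv (hf : IsGenerator α U f) :
    ContinuousOn (generatorInv f U) (f '' U) := by
  rintro _ ⟨z, hz, rfl⟩
  refine ContinuousAt.continuousWithinAt ?_
  rw [ContinuousAt, hf.generatorInv_apply hz]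
  intro V hV
  obtain ⟨W, hWV, hWo, hzW⟩ := mem_nhds_iff.1 (inter_mem hV (hf.isOpen.mem_nhds hz))
  have hopen := hf.isOpen_image hWo (fun x hx => (hWV hx).2)
  refine mem_map.2 (mem_of_superset (hopen.mem_nhds ⟨z, hzW, rfl⟩) ?_)
  rintro _ ⟨x, hx, rfl⟩
  rw [mem_preimage, hf.generatorInv_apply (hWV hx).2]
  exact (hWV hx).1

theorem nonempty_interior_image (hf : IsGenerator α U f) :
    (interior (f '' closedUpperHalfPlaneMinus α)).Nonempty := by
  have hsub : {z : ℂ | 0 < z.im} ⊆ closedUpperHalfPlaneMinus α := fun z hz =>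
    ⟨le_of_lt (a := (0 : ℝ)) hz, fun h => absurd hf.im_nonpos (by
      rw [mem_singleton_iff] at h; rw [← h]; exact not_le.2 hz)⟩
  have ho : IsOpen {z : ℂ | 0 < z.im} := isOpen_lt continuous_const Complex.continuous_im
  exact ⟨f Complex.I, mem_interior.2 ⟨_, image_mono hsub,
    hf.isOpen_image ho (hsub.trans hf.subset), ⟨_, by simp, rfl⟩⟩⟩

/-- The restriction of the generator to the real axis is measurable. -/
theorem measurable_ofReal (hf : IsGenerator α U f) : Measurable fun x : ℝ => f x := by
  -- The only real point possibly outside `U` is `α`, when `α` is real.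
  refine measurable_of_continuousOn_compl_singleton α.re ?_
  have hmaps : MapsTo (fun x : ℝ => (x : ℂ)) {α.re}ᶜ U := fun x hx =>
    hf.subset ⟨by simp, fun h => hx (by rw [mem_singleton_iff] at h ⊢; rw [← h]; simp)⟩
  exact hf.holomorphic.continuousOn.comp Complex.continuous_ofReal.continuousOn hmaps

theorem exists_lipschitzOnWith_ball (hf : IsGenerator α U f) {m : ℂ} (hm : m ∈ U) :
    ∃ K : NNReal, ∃ r > 0, LipschitzOnWith K f (Metric.ball m r) := by
  have han : AnalyticAt ℂ f m := hf.holomorphic.analyticAt (hf.isOpen.mem_nhds hm)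
  obtain ⟨K, t, ht, hK⟩ := (han.contDiffAt (n := 1)).exists_lipschitzOnWith
  obtain ⟨r, hr, hrt⟩ := Metric.mem_nhds_iff.1 ht
  exact ⟨K, r, hr, hK.mono hrt⟩

end IsGenerator

/-! ### Characteristic functions and anti-concentration of sums -/

/-- `‖charFun μ‖ ^ 2` is the characteristic function of the difference of two independent copies. -/
theorem norm_charFun_sq_eq_integral_cos (μ : Measure ℝ) [IsProbabilityMeasure μ] (s : ℝ) :
    ‖charFun μ s‖ ^ 2 = ∫ z, Real.cos (s * (z.1 - z.2)) ∂(μ.prod μ) := by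
  have h1 : charFun μ s * charFun μ (-s)
      = ∫ z, Complex.exp (((s * (z.1 - z.2) : ℝ) : ℂ) * Complex.I) ∂(μ.prod μ) := by
    rw [charFun_apply_real, charFun_apply_real, ← integral_prod_mul]
    congr 1 with z
    rw [← Complex.exp_add]
    congr 1
    push_cast
    ring
  have hint : Integrable
      (fun z : ℝ × ℝ => Complex.exp (((s * (z.1 - z.2) : ℝ) : ℂ) * Complex.I)) (μ.prod μ) := by
    refine Integrable.of_bound (C := 1) ?_ (ae_of_all _ fun z => ?_)
    · exact Measurable.aestronglyMeasurable (by fun_prop)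
    · rw [Complex.norm_exp_ofReal_mul_I]
  have h2 := congrArg Complex.re h1
  rw [charFun_neg, Complex.mul_conj, Complex.ofReal_re, Complex.normSq_eq_norm_sq] at h2
  rw [h2]
  have h3 := integral_re hint
  simp only [RCLike.re_to_complex, Complex.exp_ofReal_mul_I_re] at h3
  exact h3.symm

/-- For a law with infinite second moment, so has its symmetrization. -/
theorem lintegral_prod_sub_sq_eq_top {μ : Measure ℝ} [IsProbabilityMeasure μ]
    (hμ : ¬ MemLp (id : ℝ → ℝ) 2 μ) {c : ℝ} (hc : 0 < c) :
    ∫⁻ z, ENNReal.ofReal (c * (z.1 - z.2) ^ 2) ∂(μ.prod μ) = ∞ := by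
  by_contra hfin
  have hint : Integrable (fun z : ℝ × ℝ => c * (z.1 - z.2) ^ 2) (μ.prod μ) := by
    refine ⟨Measurable.aestronglyMeasurable (by fun_prop), ?_⟩
    rw [hasFiniteIntegral_iff_ofReal (ae_of_all _ fun z => by positivity)]
    exact Ne.lt_top hfin
  -- Fubini: freeze one copy at a value for which the other remains square integrable.
  obtain ⟨x, hx⟩ := hint.prod_right_ae.exists
  refine hμ ?_
  have hm : MemLp (fun y : ℝ => x - y) 2 μ := by
    rw [memLp_two_iff_integrable_sq (Measurable.aestronglyMeasurable (by fun_prop))]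
    have h := hx.const_mul c⁻¹
    refine h.congr (ae_of_all _ fun y => ?_)
    simp only
    field_simp
  have h := (memLp_const (μ := μ) (p := 2) x).sub hm
  refine h.ae_eq (ae_of_all _ fun y => ?_)
  simp

/-- With `D` the symmetrized variable, this is the mean of `n * (1 - cos (t * D / √n))`. The bound
`cos x ≤ 1 - 2 / π ^ 2 * x ^ 2` for `|x| ≤ π` makes the integrand eventually at least a multiple of
`D ^ 2`, whose mean is infinite; Fatou concludes. -/
theorem tendsto_mul_one_sub_norm_charFun_sq {μ : Measure ℝ} [IsProbabilityMeasure μ]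
    (hμ : ¬ MemLp (id : ℝ → ℝ) 2 μ) {t : ℝ} (ht : t ≠ 0) :
    Tendsto (fun n : ℕ => (n : ℝ) * (1 - ‖charFun μ ((√n)⁻¹ * t)‖ ^ 2)) atTop atTop := by
  let g : ℕ → ℝ × ℝ → ℝ := fun n z => (n : ℝ) * (1 - Real.cos ((√n)⁻¹ * t * (z.1 - z.2)))
  have hg_meas : ∀ n, Measurable (g n) := fun n => by simp only [g]; fun_prop
  have hg_nonneg : ∀ n z, 0 ≤ g n z := fun n z =>
    mul_nonneg n.cast_nonneg (sub_nonneg.2 (Real.cos_le_one _))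
  have hcos : ∀ n : ℕ,
      Integrable (fun z : ℝ × ℝ => Real.cos ((√n)⁻¹ * t * (z.1 - z.2))) (μ.prod μ) := by
    intro n
    refine Integrable.of_bound (C := 1) (Measurable.aestronglyMeasurable (by fun_prop))
      (ae_of_all _ fun z => ?_)
    rw [Real.norm_eq_abs]
    exact Real.abs_cos_le_one _
  have hg_int : ∀ n : ℕ, ENNReal.ofReal ((n : ℝ) * (1 - ‖charFun μ ((√n)⁻¹ * t)‖ ^ 2))
      = ∫⁻ z, ENNReal.ofReal (g n z) ∂(μ.prod μ) := by
    intro n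
    have hi : Integrable (g n) (μ.prod μ) := ((integrable_const _).sub (hcos n)).const_mul _
    rw [← ofReal_integral_eq_lintegral_ofReal hi (ae_of_all _ (hg_nonneg n)),
      norm_charFun_sq_eq_integral_cos]
    congr 1
    simp only [g]
    rw [integral_const_mul, integral_sub (integrable_const _) (hcos n)]
    simp
  rw [← ENNReal.tendsto_ofReal_nhds_top]
  simp_rw [hg_int]
  have hc : 0 < 2 / Real.pi ^ 2 * t ^ 2 := by positivity
  have hpt : ∀ z : ℝ × ℝ, ENNReal.ofReal (2 / Real.pi ^ 2 * t ^ 2 * (z.1 - z.2) ^ 2)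
      ≤ liminf (fun n => ENNReal.ofReal (g n z)) atTop := by
    intro z
    refine le_liminf_of_le (by isBoundedDefault) ?_
    have hlim : Tendsto (fun n : ℕ => (√n)⁻¹ * t * (z.1 - z.2)) atTop (𝓝 0) := by
      have h := ((tendsto_inv_atTop_zero.comp (Real.tendsto_sqrt_atTop.comp
        tendsto_natCast_atTop_atTop)).mul_const t).mul_const (z.1 - z.2)
      simpa using h
    have hsmall := hlim.abs.eventually_le_const (by simpa using Real.pi_pos)
    filter_upwards [hsmall, eventually_gt_atTop 0] with n hn hn0
    refine ENNReal.ofReal_le_ofReal ?_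
    have h := Real.cos_le_one_sub_mul_cos_sq hn
    have hn0' : (0 : ℝ) < n := by exact_mod_cast hn0
    have hsq : (n : ℝ) * ((√n)⁻¹ * t * (z.1 - z.2)) ^ 2 = t ^ 2 * (z.1 - z.2) ^ 2 := by
      rw [mul_pow, mul_pow, inv_pow, Real.sq_sqrt hn0'.le]
      field_simp
    calc 2 / Real.pi ^ 2 * t ^ 2 * (z.1 - z.2) ^ 2
        = 2 / Real.pi ^ 2 * ((n : ℝ) * ((√n)⁻¹ * t * (z.1 - z.2)) ^ 2) := by rw [hsq]; ring
      _ = (n : ℝ) * (2 / Real.pi ^ 2 * ((√n)⁻¹ * t * (z.1 - z.2)) ^ 2) := by ring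
      _ ≤ g n z := by
        refine mul_le_mul_of_nonneg_left ?_ hn0'.le
        linarith
  refine tendsto_of_le_liminf_of_limsup_le ?_ le_top
  rw [← lintegral_prod_sub_sq_eq_top hμ hc]
  exact (lintegral_mono hpt).trans (lintegral_liminf_le fun n => (hg_meas n).ennreal_ofReal)

theorem tendsto_norm_charFun_pow {μ : Measure ℝ} [IsProbabilityMeasure μ]
    (hμ : ¬ MemLp (id : ℝ → ℝ) 2 μ) {t : ℝ} (ht : t ≠ 0) :
    Tendsto (fun n : ℕ => ‖charFun μ ((√n)⁻¹ * t) ^ n‖) atTop (𝓝 0) := by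
  have hexp := Real.tendsto_exp_neg_atTop_nhds_zero.comp (tendsto_mul_one_sub_norm_charFun_sq hμ ht)
  have hsq : Tendsto (fun n : ℕ => ‖charFun μ ((√n)⁻¹ * t) ^ n‖ ^ 2) atTop (𝓝 0) := by
    refine squeeze_zero (fun n => by positivity) (fun n => ?_) hexp
    set x := ‖charFun μ ((√n)⁻¹ * t)‖ ^ 2
    have hx : x ≤ Real.exp (x - 1) := by linarith [Real.add_one_le_exp (x - 1)]
    calc ‖charFun μ ((√n)⁻¹ * t) ^ n‖ ^ 2 = x ^ n := by
            rw [norm_pow, ← pow_mul, ← pow_mul, mul_comm n]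
      _ ≤ Real.exp (x - 1) ^ n := pow_le_pow_left₀ (by positivity) hx n
      _ = Real.exp (-(n * (1 - x))) := by rw [← Real.exp_nat_mul]; congr 1; ring
  have h := hsq.sqrt
  simpa only [Real.sqrt_sq (norm_nonneg _), Real.sqrt_zero] using h

/-- The Gaussian bump is itself the characteristic function of a standard normal, so Fubini applies.
The centre `a` enters only as a phase, hence the bound is uniform in it. -/
theorem integral_exp_neg_sq_le_integral_norm_charFun (μ : Measure ℝ) [IsProbabilityMeasure μ]
    (a : ℝ) : ∫ x, Real.exp (-(x - a) ^ 2 / 2) ∂μ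
      ≤ ∫ t, ‖charFun μ t‖ ∂(gaussianReal 0 1) := by
  set γ := gaussianReal 0 1
  have hγ : ∀ x : ℝ, ((Real.exp (-(x - a) ^ 2 / 2) : ℝ) : ℂ)
      = ∫ t, Complex.exp (((t * (x - a) : ℝ) : ℂ) * Complex.I) ∂γ := by
    intro x
    have h := charFun_gaussianReal (μ := 0) (v := 1) (x - a)
    rw [charFun_apply_real] at h
    push_cast at h ⊢
    rw [show (∫ t : ℝ, Complex.exp (t * (x - a) * Complex.I) ∂γ)
      = ∫ t : ℝ, Complex.exp ((x - a) * t * Complex.I) ∂γ by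
        congr 1 with t; congr 1; ring, h]
    congr 1
    simp
    ring
  have hint : Integrable (Function.uncurry fun x t : ℝ =>
      Complex.exp (((t * (x - a) : ℝ) : ℂ) * Complex.I)) (μ.prod γ) := by
    refine Integrable.of_bound (C := 1) ?_ (ae_of_all _ fun z => ?_)
    · exact Measurable.aestronglyMeasurable (by unfold Function.uncurry; fun_prop)
    · rw [Function.uncurry, Complex.norm_exp_ofReal_mul_I]
  have hinner : ∀ t : ℝ, ‖∫ x, Complex.exp (((t * (x - a) : ℝ) : ℂ) * Complex.I) ∂μ‖
      = ‖charFun μ t‖ := by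
    intro t
    have h : ∀ x : ℝ, Complex.exp (((t * (x - a) : ℝ) : ℂ) * Complex.I)
        = Complex.exp (((-(t * a) : ℝ) : ℂ) * Complex.I) * Complex.exp (t * x * Complex.I) := by
      intro x
      rw [← Complex.exp_add]
      congr 1
      push_cast
      ring
    simp_rw [h]
    rw [integral_const_mul, norm_mul, Complex.norm_exp_ofReal_mul_I, one_mul, charFun_apply_real]
  have hswap : ((∫ x, Real.exp (-(x - a) ^ 2 / 2) ∂μ : ℝ) : ℂ)
      = ∫ t, ∫ x, Complex.exp (((t * (x - a) : ℝ) : ℂ) * Complex.I) ∂μ ∂γ := by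
    rw [← integral_integral_swap hint, ← integral_complex_ofReal]
    exact integral_congr_ae (ae_of_all _ hγ)
  calc ∫ x, Real.exp (-(x - a) ^ 2 / 2) ∂μ
      ≤ ‖((∫ x, Real.exp (-(x - a) ^ 2 / 2) ∂μ : ℝ) : ℂ)‖ := by
        rw [Complex.norm_real]; exact le_abs_self _
    _ ≤ ∫ t, ‖∫ x, Complex.exp (((t * (x - a) : ℝ) : ℂ) * Complex.I) ∂μ‖ ∂γ := by
        rw [hswap]; exact norm_integral_le_integral_norm _
    _ = ∫ t, ‖charFun μ t‖ ∂γ := by simp_rw [hinner]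

/-- If the characteristic functions vanish in the limit away from the origin, then the mass of
intervals of bounded length, with arbitrary centers, tends to zero. -/
theorem tendsto_measure_interval_of_charFun {μ : ℕ → Measure ℝ} [∀ n, IsProbabilityMeasure (μ n)]
    (h : ∀ t ≠ 0, Tendsto (fun n => ‖charFun (μ n) t‖) atTop (𝓝 0)) (a : ℕ → ℝ) (K : ℝ) :
    Tendsto (fun n => μ n {x | |x - a n| ≤ K}) atTop (𝓝 0) := by
  have hdct : Tendsto (fun n => ∫ t, ‖charFun (μ n) t‖ ∂(gaussianReal 0 1)) atTop (𝓝 0) := by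
    have := tendsto_integral_of_dominated_convergence (μ := gaussianReal 0 1)
      (F := fun n t => ‖charFun (μ n) t‖) (f := fun _ => 0) (fun _ => 1)
      (fun n => measurable_charFun.norm.aestronglyMeasurable) (integrable_const _)
      (fun n => ae_of_all _ fun t => by simpa using norm_charFun_le_one t) ?_
    · simpa using this
    · have := nullSingletonClass_gaussianReal (μ := 0) (v := 1) one_ne_zero
      -- The origin, where no decay is possible, is a Gaussian null set.
      have h0 : ∀ᵐ t ∂(gaussianReal 0 1), t ≠ 0 := by
        simp [ae_iff]
      filter_upwards [h0] with t ht using h t ht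
  have hbound : ∀ n, (μ n).real {x | |x - a n| ≤ K}
      ≤ Real.exp (K ^ 2 / 2) * ∫ t, ‖charFun (μ n) t‖ ∂(gaussianReal 0 1) := by
    intro n
    have hint : Integrable (fun x => Real.exp (-(x - a n) ^ 2 / 2)) (μ n) := by
      refine Integrable.of_bound (C := 1) (Measurable.aestronglyMeasurable (by fun_prop))
        (ae_of_all _ fun x => ?_)
      rw [Real.norm_eq_abs, Real.abs_exp, Real.exp_le_one_iff]
      nlinarith [sq_nonneg (x - a n)]
    have hM := mul_meas_ge_le_integral_of_nonneg (ae_of_all _ fun x => (Real.exp_pos _).le) hint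
      (Real.exp (-K ^ 2 / 2))
    -- On the window the bump is at least `exp (-K ^ 2 / 2)`, so Markov applies.
    have hsub : {x | |x - a n| ≤ K}
        ⊆ {x | Real.exp (-K ^ 2 / 2) ≤ Real.exp (-(x - a n) ^ 2 / 2)} := by
      intro x hx
      have h1 : |x - a n| ≤ K := hx
      have h2 : (x - a n) ^ 2 ≤ K ^ 2 := by
        rw [← sq_abs (x - a n)]
        exact pow_le_pow_left₀ (abs_nonneg _) h1 2
      exact Real.exp_le_exp.2 (by linarith)
    have h3 := hM.trans (integral_exp_neg_sq_le_integral_norm_charFun (μ n) (a n))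
    have h4 := measureReal_mono (μ := μ n) hsub
    have h5 : Real.exp (K ^ 2 / 2) * Real.exp (-K ^ 2 / 2) = 1 := by
      rw [← Real.exp_add]; simp; ring
    calc (μ n).real {x | |x - a n| ≤ K} ≤ _ := h4
      _ = Real.exp (K ^ 2 / 2) * (Real.exp (-K ^ 2 / 2) * _) := by rw [← mul_assoc, h5, one_mul]
      _ ≤ _ := mul_le_mul_of_nonneg_left h3 (Real.exp_pos _).le
  have hreal : Tendsto (fun n => (μ n).real {x | |x - a n| ≤ K}) atTop (𝓝 0) := by
    refine squeeze_zero (fun n => measureReal_nonneg) hbound ?_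
    simpa using hdct.const_mul (Real.exp (K ^ 2 / 2))
  have h := ENNReal.tendsto_ofReal hreal
  simpa [ofReal_measureReal] using h

/-- Anti-concentration: the partial sums of i.i.d. real random variables with infinite second
moment leave every window of width of order `√n`, with arbitrary centers. -/
theorem tendsto_measure_abs_sum_sub_le {Ω : Type*} [MeasurableSpace Ω] {P : Measure Ω}
    [IsProbabilityMeasure P] {Y : ℕ → Ω → ℝ} (hindep : iIndepFun Y P)
    (hident : ∀ i, IdentDistrib (Y i) (Y 0) P P) (hY : ¬ MemLp (Y 0) 2 P) (a : ℕ → ℝ) (K : ℝ) :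
    Tendsto (fun n : ℕ => P {ω | |∑ k ∈ Finset.range n, Y k ω - a n| ≤ K * √n}) atTop (𝓝 0) := by
  have mY : ∀ i, AEMeasurable (Y i) P := fun i => (hident i).aemeasurable_fst
  have mW : ∀ n : ℕ, AEMeasurable (fun ω => (√n)⁻¹ * ∑ k ∈ Finset.range n, Y k ω) P := fun n =>
    (Finset.aemeasurable_fun_sum _ fun i _ => mY i).const_mul _
  have : ∀ n : ℕ,
      IsProbabilityMeasure (P.map (fun ω => (√n)⁻¹ * ∑ k ∈ Finset.range n, Y k ω)) := fun n =>
    Measure.isProbabilityMeasure_map (mW n)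
  have := Measure.isProbabilityMeasure_map (mY 0)
  have hid : ¬ MemLp (id : ℝ → ℝ) 2 (P.map (Y 0)) := by
    rwa [memLp_map_measure_iff measurable_id.aestronglyMeasurable (mY 0)]
  have h := tendsto_measure_interval_of_charFun
    (μ := fun n : ℕ => P.map (fun ω => (√n)⁻¹ * ∑ k ∈ Finset.range n, Y k ω))
    (fun t ht => by
      simp_rw [charFun_inv_sqrt_mul_sum hindep hident]
      exact tendsto_norm_charFun_pow hid ht) (fun n => (√n)⁻¹ * a n) K
  refine h.congr' ?_
  filter_upwards [eventually_gt_atTop 0] with n hn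
  have hn' : 0 < √(n : ℝ) := Real.sqrt_pos.2 (by exact_mod_cast hn)
  rw [Measure.map_apply_of_aemeasurable (mW n)
    (measurableSet_le (by fun_prop) measurable_const)]
  congr 1
  ext ω
  change |(√n)⁻¹ * ∑ k ∈ Finset.range n, Y k ω - (√n)⁻¹ * a n| ≤ K ↔
    |∑ k ∈ Finset.range n, Y k ω - a n| ≤ K * √n
  rw [← mul_sub, abs_mul, abs_of_pos (inv_pos.2 hn'), inv_mul_le_iff₀ hn', mul_comm K]

/-- The real or the imaginary part already fails to be in `L²`, and projecting does not increase
distances. -/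
theorem tendsto_measure_norm_sum_sub_le {Ω : Type*} [MeasurableSpace Ω] {P : Measure Ω}
    [IsProbabilityMeasure P] {Z : ℕ → Ω → ℂ} (hindep : iIndepFun Z P)
    (hident : ∀ i, IdentDistrib (Z i) (Z 0) P P) (hZ : ¬ MemLp (Z 0) 2 P) (a : ℕ → ℂ) (K : ℝ) :
    Tendsto (fun n : ℕ => P {ω | ‖∑ k ∈ Finset.range n, Z k ω - a n‖ ≤ K * √n}) atTop (𝓝 0) := by
  rw [← memLp_re_im_iff, not_and_or] at hZ
  rcases hZ with h | h
  · refine tendsto_of_tendsto_of_tendsto_of_le_of_le tendsto_const_nhds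
      (tendsto_measure_abs_sum_sub_le (Y := fun i ω => (Z i ω).re)
        (hindep.comp (fun _ => Complex.re) fun _ => Complex.measurable_re)
        (fun i => (hident i).comp Complex.measurable_re) h (fun n => (a n).re) K)
      (fun n => zero_le) (fun n => measure_mono fun ω hω => ?_)
    change |∑ k ∈ Finset.range n, (Z k ω).re - (a n).re| ≤ K * √n
    rw [← Complex.re_sum, ← Complex.sub_re]
    exact (Complex.abs_re_le_norm _).trans hω
  · refine tendsto_of_tendsto_of_tendsto_of_le_of_le tendsto_const_nhds
      (tendsto_measure_abs_sum_sub_le (Y := fun i ω => (Z i ω).im)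
        (hindep.comp (fun _ => Complex.im) fun _ => Complex.measurable_im)
        (fun i => (hident i).comp Complex.measurable_im) h (fun n => (a n).im) K)
      (fun n => zero_le) (fun n => measure_mono fun ω hω => ?_)
    change |∑ k ∈ Finset.range n, (Z k ω).im - (a n).im| ≤ K * √n
    rw [← Complex.im_sum, ← Complex.sub_im]
    exact (Complex.abs_im_le_norm _).trans hω

/-! ### Transfer through a Lipschitz map and consequences -/

section DeltaMethod

variable {Ω : Type*} [MeasurableSpace Ω] {P : Measure Ω}

/-- Anti-concentration at scale `1 / √n` is pulled back along a function that is Lipschitz near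
the limit in probability. -/
theorem tendsto_measure_norm_sub_le_of_lipschitz {f : ℂ → ℂ} {m : ℂ} {L : NNReal}
    {r : ℝ} (hr : 0 < r) (hL : LipschitzOnWith L f (Metric.ball m r)) {M S : ℕ → Ω → ℂ}
    (hS : ∀ n, 1 ≤ n → ∀ᵐ ω ∂P, f (M n ω) = S n ω) (hM : TendstoInMeasure P M atTop fun _ => m)
    (hconc : ∀ (a : ℕ → ℂ) (K : ℝ), Tendsto (fun n : ℕ => P {ω | ‖S n ω - a n‖ ≤ K / √n})
      atTop (𝓝 0)) (c : ℕ → ℂ) (K : ℝ) :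
    Tendsto (fun n : ℕ => P {ω | ‖M n ω - c n‖ ≤ K / √n}) atTop (𝓝 0) := by
  have h1 := hconc (fun n => f (c n)) (L * K)
  have h2 := tendstoInMeasure_iff_dist.1 hM (r / 4) (by positivity)
  have h3 := h1.add h2
  rw [add_zero] at h3
  have hK : Tendsto (fun n : ℕ => K / √n) atTop (𝓝 0) :=
    tendsto_const_nhds.div_atTop (Real.tendsto_sqrt_atTop.comp tendsto_natCast_atTop_atTop)
  refine tendsto_of_tendsto_of_tendsto_of_le_of_le' tendsto_const_nhds h3
    (Eventually.of_forall fun n => zero_le) ?_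
  filter_upwards [hK.eventually_le_const (show 0 < r / 4 by positivity), eventually_ge_atTop 1]
    with n hn hn1
  refine le_trans (measure_mono_ae ?_) (measure_union_le _ _)
  filter_upwards [hS n hn1] with ω hω hle
  replace hle : ‖M n ω - c n‖ ≤ K / √n := hle
  -- The centres need not converge: if `M n ω` is within `r / 4` of both `m` and `c n`, then `c n`
  -- also lies in the ball.
  by_cases hfar : r / 4 ≤ dist (M n ω) m
  · exact Or.inr hfar
  · left
    push Not at hfar
    have hMb : M n ω ∈ Metric.ball m r := Metric.mem_ball.2 (by linarith)
    have hcb : c n ∈ Metric.ball m r := by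
      rw [Metric.mem_ball]
      have := dist_triangle_left (c n) m (M n ω)
      rw [dist_eq_norm (M n ω) (c n)] at this
      linarith
    change ‖S n ω - f (c n)‖ ≤ L * K / √n
    rw [← hω, ← dist_eq_norm, mul_div_assoc]
    refine (hL.dist_le_mul _ hMb _ hcb).trans ?_
    rw [dist_eq_norm]
    exact mul_le_mul_of_nonneg_left hle L.coe_nonneg

theorem tendsto_mul_lintegral_sq_of_anticoncentration [IsProbabilityMeasure P] {M : ℕ → Ω → ℂ}
    (hM : ∀ n, AEMeasurable (M n) P) {c : ℕ → ℂ}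
    (h : ∀ K : ℝ, Tendsto (fun n : ℕ => P {ω | ‖M n ω - c n‖ ≤ K / √n}) atTop (𝓝 0)) :
    Tendsto (fun n : ℕ => (n : ℝ≥0∞) * ∫⁻ ω, ‖M n ω - c n‖ₑ ^ 2 ∂P) atTop (𝓝 ∞) := by
  rw [ENNReal.tendsto_nhds_top_iff_nat]
  intro N
  -- Window `N + 1` and probability `1 / 2` suffice because `(N + 1) ^ 2 / 2 > N`.
  have hhalf := (h (N + 1)).eventually_lt_const (show (0 : ℝ≥0∞) < 2⁻¹ by simp)
  filter_upwards [hhalf, eventually_ge_atTop 1] with n hn hn1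
  have hn0 : (0 : ℝ) < n := by exact_mod_cast hn1
  set A := {ω | ‖M n ω - c n‖ ≤ ((N : ℝ) + 1) / √n}
  have hcompl : 2⁻¹ ≤ P Aᶜ := by
    by_contra hcon
    push Not at hcon
    have h1 := measure_univ_le_add_compl (μ := P) A
    have h2 := ENNReal.add_lt_add hn hcon
    rw [ENNReal.inv_two_add_inv_two] at h2
    rw [measure_univ] at h1
    exact absurd h1 (not_le.2 h2)
  have hmeas : AEMeasurable (fun ω => (n : ℝ≥0∞) * ‖M n ω - c n‖ₑ ^ 2) P :=
    ((((hM n).sub_const _).enorm).pow_const 2).const_mul _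
  have hmarkov := mul_meas_ge_le_lintegral₀ hmeas (((N : ℝ≥0∞) + 1) ^ 2)
  rw [lintegral_const_mul'' _ (((hM n).sub_const _).enorm.pow_const 2)] at hmarkov
  refine lt_of_lt_of_le ?_ hmarkov
  have hsub : Aᶜ ⊆ {ω | ((N : ℝ≥0∞) + 1) ^ 2 ≤ (n : ℝ≥0∞) * ‖M n ω - c n‖ₑ ^ 2} := by
    intro ω hω
    have h1 : ((N : ℝ) + 1) / √n < ‖M n ω - c n‖ := not_le.1 hω
    have h2 : ((N : ℝ) + 1) ^ 2 ≤ n * ‖M n ω - c n‖ ^ 2 := by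
      have h3 := pow_le_pow_left₀ (by positivity) h1.le 2
      rw [div_pow, Real.sq_sqrt hn0.le, div_le_iff₀ hn0] at h3
      linarith
    have h4 := ENNReal.ofReal_le_ofReal h2
    rw [ENNReal.ofReal_mul hn0.le, ENNReal.ofReal_pow (by positivity),
      ENNReal.ofReal_pow (norm_nonneg _), ofReal_norm, ENNReal.ofReal_natCast,
      ENNReal.ofReal_add (by positivity) zero_le_one, ENNReal.ofReal_natCast,
      ENNReal.ofReal_one] at h4
    exact h4
  have hnum : (N : ℝ≥0∞) < ((N : ℝ≥0∞) + 1) ^ 2 * 2⁻¹ := by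
    rw [← div_eq_mul_inv, ENNReal.lt_div_iff_mul_lt (by simp) (by simp)]
    exact_mod_cast (by nlinarith : N * 2 < (N + 1) ^ 2)
  exact hnum.trans_le (mul_le_mul_right (hcompl.trans (measure_mono hsub)) _)

/-- By the portmanteau theorem on open balls, a limit law would give every ball mass zero. -/
theorem not_tendstoInDistribution_of_anticoncentration [IsProbabilityMeasure P] {W : ℕ → Ω → ℂ}
    (h : ∀ K : ℝ, Tendsto (fun n : ℕ => P {ω | ‖W n ω‖ ≤ K}) atTop (𝓝 0)) :
    ¬ ∃ (ν : Measure ℂ) (_ : IsProbabilityMeasure ν),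
      TendstoInDistribution W atTop (id : ℂ → ℂ) (fun _ => P) ν := by
  rintro ⟨ν, _, hν⟩
  have hball : ∀ k : ℕ, ν (Metric.ball 0 k) = 0 := by
    intro k
    have h1 := ProbabilityMeasure.le_liminf_measure_open_of_tendsto hν.tendsto
      (Metric.isOpen_ball (x := (0 : ℂ)) (ε := k))
    simp only [ProbabilityMeasure.coe_mk, Measure.map_id] at h1
    refine le_antisymm (h1.trans ?_) zero_le
    rw [← (h k).liminf_eq]
    refine liminf_le_liminf (Eventually.of_forall fun n => ?_)
    rw [Measure.map_apply_of_aemeasurable (hν.forall_aemeasurable n) Metric.isOpen_ball.measurableSet]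
    refine measure_mono fun ω hω => ?_
    exact (mem_ball_zero_iff.1 hω).le
  have h0 : ν univ = 0 := by
    rw [← Metric.iUnion_ball_nat (0 : ℂ)]
    exact measure_iUnion_null hball
  simp at h0

end DeltaMethod

/-! ### Quasi-arithmetic means: measurability, strong law, anti-concentration -/

namespace IsGenerator

variable {α : ℂ} {U : Set ℂ} {f : ℂ → ℂ} {Ω : Type*} {X : ℕ → Ω → ℝ}

theorem generatorAverage_mem (hf : IsGenerator α U f) {ω : Ω}
    (hω : ∀ j, (X j ω : ℂ) ∈ closedUpperHalfPlaneMinus α) {n : ℕ} (hn : 1 ≤ n) :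
    generatorAverage f X n ω ∈ f '' closedUpperHalfPlaneMinus α := by
  have hn0 : (n : ℝ) ≠ 0 := by positivity
  have h := hf.convex_image.sum_mem (t := Finset.range n) (w := fun _ => (n : ℝ)⁻¹)
    (z := fun j => f (X j ω)) (fun _ _ => by positivity) (by simp [hn0])
    (fun j _ => ⟨_, hω j, rfl⟩)
  convert h using 1
  rw [generatorAverage, ← Finset.smul_sum, Complex.real_smul, div_eq_inv_mul]
  push_cast
  rfl

variable [MeasurableSpace Ω] {P : Measure Ω}

theorem ae_mem (hident : ∀ i, IdentDistrib (X i) (X 0) P P)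
    (hcont : ∀ x : ℝ, P {ω | X 0 ω = x} = 0) :
    ∀ᵐ ω ∂P, ∀ j, (X j ω : ℂ) ∈ closedUpperHalfPlaneMinus α := by
  rw [ae_all_iff]
  intro j
  have h : ∀ᵐ ω ∂P, X j ω ≠ α.re := by
    have h1 := (hident j).measure_mem_eq (measurableSet_singleton α.re)
    rw [ae_iff]
    simp only [ne_eq, not_not]
    exact h1.trans (hcont _)
  filter_upwards [h] with ω hω
  refine ⟨by simp, fun hc => hω ?_⟩
  rw [mem_singleton_iff] at hc
  rw [← hc, Complex.ofReal_re]

theorem aemeasurable_quasiArithmeticMean (hf : IsGenerator α U f) (hX : ∀ i, Measurable (X i))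
    (hmem : ∀ᵐ ω ∂P, ∀ j, (X j ω : ℂ) ∈ closedUpperHalfPlaneMinus α) (n : ℕ) :
    AEMeasurable (quasiArithmeticMean f U X n) P := by
  rcases Nat.eq_zero_or_pos n with rfl | hn
  · refine (aemeasurable_const (b := generatorInv f U 0)).congr (ae_of_all _ fun ω => ?_)
    simp [quasiArithmeticMean, generatorAverage]
  · classical
    have hU : IsOpen (f '' U) := hf.isOpen_image hf.isOpen subset_rfl
    -- The inverse is controlled only on `f '' U`, where the averages almost surely lie; elsewhere
    -- it is replaced by `0`.
    have hg : Measurable ((f '' U).piecewise (generatorInv f U) fun _ => 0) :=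
      hf.continuousOn_generatorInv.measurable_piecewise continuousOn_const hU.measurableSet
    have havg : Measurable (generatorAverage f X n) :=
      (Finset.measurable_fun_sum _ fun j _ => hf.measurable_ofReal.comp (hX j)).div_const _
    refine (hg.comp havg).aemeasurable.congr ?_
    filter_upwards [hmem] with ω hω
    exact piecewise_eq_of_mem _ _ _ (image_mono hf.subset (hf.generatorAverage_mem hω hn))

theorem tendsto_quasiArithmeticMean (hf : IsGenerator α U f)
    (hindep : iIndepFun X P) (hident : ∀ i, IdentDistrib (X i) (X 0) P P)
    (hint : Integrable (fun ω => f (X 0 ω)) P)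
    (hmean : ∫ ω, f (X 0 ω) ∂P ∈ f '' U) :
    ∀ᵐ ω ∂P, Tendsto (fun n => quasiArithmeticMean f U X n ω) atTop
      (𝓝 (generatorInv f U (∫ ω, f (X 0 ω) ∂P))) := by
  have hlln := strong_law_ae (fun i ω => f (X i ω)) hint
    (fun i j hij => (hindep.indepFun hij).comp hf.measurable_ofReal hf.measurable_ofReal)
    (fun i => (hident i).comp hf.measurable_ofReal)
  have hcts : ContinuousAt (generatorInv f U) (∫ ω, f (X 0 ω) ∂P) :=
    hf.continuousOn_generatorInv.continuousAt
      ((hf.isOpen_image hf.isOpen subset_rfl).mem_nhds hmean)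
  filter_upwards [hlln] with ω hω
  refine (hcts.tendsto.comp hω).congr fun n => ?_
  rw [Function.comp_apply, quasiArithmeticMean, generatorAverage, Complex.real_smul,
    div_eq_inv_mul]
  push_cast
  rfl

theorem tendsto_measure_norm_generatorAverage_sub_le [IsProbabilityMeasure P]
    (hf : IsGenerator α U f)
    (hindep : iIndepFun X P) (hident : ∀ i, IdentDistrib (X i) (X 0) P P)
    (hL2 : ¬ MemLp (fun ω => f (X 0 ω)) 2 P) (a : ℕ → ℂ) (K : ℝ) :
    Tendsto (fun n : ℕ => P {ω | ‖generatorAverage f X n ω - a n‖ ≤ K / √n}) atTop (𝓝 0) := by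
  have h := tendsto_measure_norm_sum_sub_le (Z := fun i ω => f (X i ω))
    (hindep.comp (fun _ x => f (x : ℝ)) fun _ => hf.measurable_ofReal)
    (fun i => (hident i).comp hf.measurable_ofReal) hL2 (fun n => n * a n) K
  refine h.congr' ?_
  filter_upwards [eventually_ge_atTop 1] with n hn
  have hn0 : (0 : ℝ) < n := by exact_mod_cast hn
  have hnc : (n : ℂ) ≠ 0 := by exact_mod_cast hn0.ne'
  congr 1
  ext ω
  change ‖_‖ ≤ _ ↔ ‖_‖ ≤ _
  have h1 : ∑ k ∈ Finset.range n, f (X k ω) - n * a n = n * (generatorAverage f X n ω - a n) := by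
    rw [generatorAverage]
    field_simp
  have h2 : K * √n = n * (K / √n) := by
    have : √(n : ℝ) ≠ 0 := (Real.sqrt_pos.2 hn0).ne'
    field_simp
    rw [Real.sq_sqrt hn0.le]
  rw [h1, h2, norm_mul, Complex.norm_natCast, mul_le_mul_iff_right₀ hn0]

end IsGenerator

/-! ### The main theorem -/

theorem mainTheorem2 {Ω : Type*} [MeasurableSpace Ω] (P : Measure Ω) [IsProbabilityMeasure P]
    (α : ℂ) (U : Set ℂ) (f : ℂ → ℂ) (hf : IsGenerator α U f)
    (X : ℕ → Ω → ℝ) (hX_meas : ∀ i, Measurable (X i))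
    (hX_indep : iIndepFun X P) (hX_ident : ∀ i, IdentDistrib (X i) (X 0) P P)
    -- the common law is continuous, i.e. has no atoms
    (hX_cont : ∀ x : ℝ, P {ω | X 0 ω = x} = 0)
    (hL1 : MemLp (fun ω => f (X 0 ω : ℂ)) 1 P)
    (hL2 : ¬ MemLp (fun ω => f (X 0 ω : ℂ)) 2 P) :
    -- the objects in the claims below are well defined
    ((∫ ω, f (X 0 ω : ℂ) ∂P) ∈ f '' closedUpperHalfPlaneMinus α ∧
      (∀ n : ℕ, 1 ≤ n →
        ∀ᵐ ω ∂P, generatorAverage f X n ω ∈ f '' closedUpperHalfPlaneMinus α) ∧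
      ∀ n : ℕ, AEMeasurable (quasiArithmeticMean f U X n) P) ∧
    -- (i)
    Tendsto (fun n : ℕ => (n : ℝ≥0∞) *
        ∫⁻ ω, ‖quasiArithmeticMean f U X n ω
          - generatorInv f U (∫ ω', f (X 0 ω' : ℂ) ∂P)‖ₑ ^ 2 ∂P) atTop (𝓝 ∞) ∧
    (¬ ∃ (ν : Measure ℂ) (_ : IsProbabilityMeasure ν),
      TendstoInDistribution
        (fun (n : ℕ) (ω : Ω) => ((Real.sqrt (n : ℝ) : ℝ) : ℂ) *
          (quasiArithmeticMean f U X n ω - generatorInv f U (∫ ω', f (X 0 ω' : ℂ) ∂P)))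
        atTop (id : ℂ → ℂ) (fun _ => P) ν) ∧
    -- (ii)
    (∀ ε₀ : ℝ, 0 < ε₀ →
      limsup (fun n : ℕ => ∫⁻ ω, ‖quasiArithmeticMean f U X n ω‖ₑ ^ (1 + ε₀) ∂P) atTop < ∞ →
      Tendsto (fun n : ℕ => (n : ℝ≥0∞) * complexVariance (quasiArithmeticMean f U X n) P)
        atTop (𝓝 ∞)) := by
  have hint : Integrable (fun ω => f (X 0 ω : ℂ)) P := memLp_one_iff_integrable.1 hL1
  have hmem : ∀ᵐ ω ∂P, ∀ j, (X j ω : ℂ) ∈ closedUpperHalfPlaneMinus α :=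
    IsGenerator.ae_mem hX_ident hX_cont
  have hmean : (∫ ω, f (X 0 ω : ℂ) ∂P) ∈ f '' closedUpperHalfPlaneMinus α :=
    hf.convex_image.integral_mem_complex hf.nonempty_interior_image hint
      (hmem.mono fun ω hω => ⟨_, hω 0, rfl⟩)
  have havg : ∀ n : ℕ, 1 ≤ n →
      ∀ᵐ ω ∂P, generatorAverage f X n ω ∈ f '' closedUpperHalfPlaneMinus α := fun n hn =>
    hmem.mono fun ω hω => hf.generatorAverage_mem hω hn
  have hmeas : ∀ n : ℕ, AEMeasurable (quasiArithmeticMean f U X n) P :=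
    hf.aemeasurable_quasiArithmeticMean hX_meas hmem
  have hmeanU := image_mono (f := f) hf.subset hmean
  obtain ⟨L, r, hr, hL⟩ := hf.exists_lipschitzOnWith_ball
    (show generatorInv f U (∫ ω, f (X 0 ω : ℂ) ∂P) ∈ U from Function.invFunOn_mem hmeanU)
  have hanti : ∀ (c : ℕ → ℂ) (K : ℝ),
      Tendsto (fun n : ℕ => P {ω | ‖quasiArithmeticMean f U X n ω - c n‖ ≤ K / √n})
        atTop (𝓝 0) :=
    tendsto_measure_norm_sub_le_of_lipschitz hr hL
      (fun n hn => (havg n hn).mono fun ω hω =>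
        Function.invFunOn_eq (image_mono (f := f) hf.subset hω))
      (tendstoInMeasure_of_tendsto_ae (fun n => (hmeas n).aestronglyMeasurable)
        (hf.tendsto_quasiArithmeticMean hX_indep hX_ident hint hmeanU))
      (hf.tendsto_measure_norm_generatorAverage_sub_le hX_indep hX_ident hL2)
  refine ⟨⟨hmean, havg, hmeas⟩,
    tendsto_mul_lintegral_sq_of_anticoncentration hmeas (hanti fun _ => _),
    not_tendstoInDistribution_of_anticoncentration fun K => ?_,
    -- The centres are the Bochner integrals of `Mₙ`; arbitrary centres are allowed, including the
    -- default value `0` for a non-integrable `Mₙ`.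
    fun _ _ _ => tendsto_mul_lintegral_sq_of_anticoncentration hmeas (hanti fun _ => _)⟩
  refine (hanti (fun _ => generatorInv f U (∫ ω, f (X 0 ω : ℂ) ∂P)) K).congr' ?_
  filter_upwards [eventually_gt_atTop 0] with n hn
  have hn' : 0 < √(n : ℝ) := Real.sqrt_pos.2 (by exact_mod_cast hn)
  congr 1
  ext ω
  change ‖_‖ ≤ _ ↔ ‖_‖ ≤ _
  rw [norm_mul, Complex.norm_real, Real.norm_of_nonneg hn'.le, le_div_iff₀' hn']
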